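/- **Theorem (fast degenerate preconditioned proximal point).** Let $H$ be a real Hilbert space, $A\colon H\to 2^H$ maximal monotone with $\operatorname{zer}A:=\{u : 0\in A(u)\}\neq\emptyset$, and $M\colon H\to H$ a bounded, self-adjoint, positive semidefinite linear operator; write $\langle u,v\rangle_M:=\langle u,Mv\rangle$ and $\|u\|_M:=\sqrt{\langle u,u\rangle_M}$. Let $M^{-1}A$ be the set-valued operator with $v\in M^{-1}A(u)$ iff $Mv\in A(u)$, and $J_{M^{-1}A}:=(I+M^{-1}A)^{-1}=(M+A)^{-1}M$ its resolvent. Assume that $(M+A)^{-1}$ is Lipschitz over $\operatorname{Im}M$ and that $J_{M^{-1}A}$ has full domain (so that $J_{M^{-1}A}$ is single-valued on $H$). Let $s\in(0,2]$, $\alpha>2$, $\theta\in(1,\alpha-1)$, $\sigma>0$, let $T:=(1-s)I+sJ_{M^{-1}A}$, and let $u^{-1},u^0\in H$ be arbitrary and, for $k\ge 0$, $$u^{k+1}=u^k+\frac{\theta}{k+\sigma}\bigl(T(u^k)-u^k\bigr)+\Bigl(1-\frac{\alpha}{k+\sigma}\Bigr)\bigl(T(u^k)-T(u^{k-1})\bigr).$$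 Then: (i) For all $z\in\operatorname{zer}A$, $$\sum_{k\in\mathbb N}\langle u^k-J_{M^{-1}A}(u^k),\,J_{M^{-1}A}(u^k)-z\rangle_M<+\infty,\quad \sum_{k\in\mathbb N}k\|u^k-J_{M^{-1}A}(u^k)\|_M^2<+\infty,\quad \sum_{k\in\mathbb N}k\|u^k-u^{k-1}\|_M^2<+\infty .$$ (ii) $(J_{M^{-1}A}(u^k))_k$ converges weakly to some $u^*\in\operatorname{zer}A$; if $s=1$, also $(u^k)_k$ converges weakly to $u^*$. (iii) As $k\to+\infty$, $\langle u^k-J_{M^{-1}A}(u^k),\,J_{M^{-1}A}(u^k)-z\rangle_M=o(k^{-1})$ for all $z\in\operatorname{zer}A$, $\|u^k-u^{k-1}\|_M=o(k^{-1})$, and $\|u^k-J_{M^{-1}A}(u^k)\|_M=o(k^{-1})$. Suppose furthermore that $M$ has closed range and that $M=CC^*$ with $C\colon D\to H$ bounded, linear and one-to-one, $D$ a real Hilbert space (an onto decomposition). Put $C^*\rhd A:=(C^*A^{-1}C)^{-1}$, a set-valued operator on $D$, with resolvent $J_{C^*\rhd A}:=(I+C^*\rhd A)^{-1}$, and $w^k:=C^*u^k$.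 Then $J_{C^*\rhd A}$ is single-valued with full domain, and, with the norm and inner product of $D$: for all $y\in\operatorname{zer}(C^*\rhd A)$, the sequence $\langle w^k-J_{C^*\rhd A}(w^k),J_{C^*\rhd A}(w^k)-y\rangle$ is summable and $o(k^{-1})$; $\sum_k k\|w^k-J_{C^*\rhd A}(w^k)\|^2<+\infty$ and $\sum_k k\|w^k-w^{k-1}\|^2<+\infty$; $\|w^k-w^{k-1}\|=o(k^{-1})$ and $\|w^k-J_{C^*\rhd A}(w^k)\|=o(k^{-1})$; and both $J_{C^*\rhd A}(w^k)$ and $w^k$ converge weakly to $C^*u^*\in\operatorname{zer}(C^*\rhd A)$, where $u^*$ is the weak limit in (ii). -/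

import Mathlib

open Filter Topology Asymptotics
open scoped RealInnerProductSpace

namespace FastKM

section SetValued

variable {X Y : Type*}

/-- Inverse of a set-valued operator: `x ∈ B⁻¹ y` iff `y ∈ B x`. -/
def inv (B : X → Set Y) : Y → Set X := fun y => {x | y ∈ B x}

/-- Zeros of a set-valued operator. -/
def zer [Zero Y] (B : X → Set Y) : Set X := {x | 0 ∈ B x}

/-- The sum `f + B` of a single-valued map `f` and a set-valued operator `B`. -/
def addMap [Add Y] (f : X → Y) (B : X → Set Y) : X → Set Y :=
  fun x => (fun b => f x + b) '' B x

/-- The resolvent `J_B = (I + B)⁻¹`, as a set-valued operator. -/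
def resolventOp [Add X] (B : X → Set X) : X → Set X := inv (addMap id B)

/-- A set-valued operator read as a map on points: the value `value B x` is the element of `B x`
when `B x` is a singleton. -/
noncomputable def value [Nonempty Y] (B : X → Set Y) : X → Y :=
  fun x => Classical.epsilon (fun y => y ∈ B x)

theorem value_mem [Nonempty Y] {B : X → Set Y} {x : X} (h : (B x).Nonempty) : value B x ∈ B x :=
  Classical.epsilon_spec h

theorem value_eq [Nonempty Y] {B : X → Set Y} {x : X} (h : ∃! y, y ∈ B x) {y : Y} (hy : y ∈ B x) :
    value B x = y :=
  h.unique (value_mem ⟨y, hy⟩) hy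

/-- `B` is Lipschitz over `S`, as a set-valued operator (in particular `B` has at most one value at
each point of `S`). -/
def IsLipschitzOver [NormedAddCommGroup X] [NormedAddCommGroup Y] (B : X → Set Y) (S : Set X) :
    Prop :=
  ∃ L : ℝ, ∀ x ∈ S, ∀ x' ∈ S, ∀ y ∈ B x, ∀ y' ∈ B x', ‖y - y'‖ ≤ L * ‖x - x'‖

end SetValued

section Hilbert

variable {H D : Type*} [NormedAddCommGroup H] [InnerProductSpace ℝ H]
  [NormedAddCommGroup D] [InnerProductSpace ℝ D]

/-- Monotonicity of a set-valued operator. -/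
def IsMonotone (A : H → Set H) : Prop :=
  ∀ u u' a a' : H, a ∈ A u → a' ∈ A u' → 0 ≤ ⟪a - a', u - u'⟫

/-- Maximal monotonicity: monotone, with graph maximal for inclusion among monotone operators. -/
def IsMaximalMonotone (A : H → Set H) : Prop :=
  IsMonotone A ∧ ∀ B : H → Set H, IsMonotone B → (∀ u, A u ⊆ B u) → B = A

/-- The composition `M⁻¹ A`: `v ∈ M⁻¹ A u` iff `M v ∈ A u`. -/
def precond (M : H →L[ℝ] H) (A : H → Set H) : H → Set H := fun u => {v | M v ∈ A u}

/-- The semi-inner product `⟨u, v⟩_M = ⟨u, M v⟩`. -/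
noncomputable def innerM (M : H →L[ℝ] H) (u v : H) : ℝ := ⟪u, M v⟫

/-- The seminorm `‖u‖_M = √⟨u, u⟩_M`. -/
noncomputable def normM (M : H →L[ℝ] H) (u : H) : ℝ := Real.sqrt (innerM M u u)

/-- The operator `C* ▷ A = (C* A⁻¹ C)⁻¹` on `D`, for `C : D → H`. -/
noncomputable def pushForward [CompleteSpace H] [CompleteSpace D]
    (C : D →L[ℝ] H) (A : H → Set H) : D → Set D :=
  inv (fun d => (ContinuousLinearMap.adjoint C) '' (inv A (C d)))

/-- `M = C C*` is an onto decomposition: `M` has closed range and `C` is one-to-one. -/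
def IsOntoDecomposition [CompleteSpace H] [CompleteSpace D]
    (M : H →L[ℝ] H) (C : D →L[ℝ] H) : Prop :=
  IsClosed (Set.range M) ∧ Function.Injective C ∧ M = C ∘L ContinuousLinearMap.adjoint C

/-- Weak convergence of a sequence. -/
def WeakTendsto (x : ℕ → H) (l : H) : Prop :=
  Tendsto (fun k => toWeakSpace ℝ H (x k)) atTop (𝓝 (toWeakSpace ℝ H l))

/-- `x⁻¹, x⁰, x¹, …` is generated by the fast Krasnoselskii–Mann method for `T` with parameters
`α, θ, σ`. Only the indices `k ≥ -1` matter; `x⁻¹` and `x⁰` are arbitrary. -/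
def IsFastKM (T : H → H) (α θ σ : ℝ) (x : ℤ → H) : Prop :=
  ∀ k : ℕ, x (k + 1) = x k + (θ / (k + σ)) • (T (x k) - x k)
    + (1 - α / (k + σ)) • (T (x k) - T (x (k - 1)))

end Hilbert

end FastKM

open FastKM

/-!
The quantities `⟨u, v⟩_M` and `‖u‖_M` are the inner product and norm of a seminormed space, in which
the resolvent `J` is firmly nonexpansive; the summability statements and the rates concern only this
seminorm. With `x k` the iterates, `G k = s (x k - J (x k))`, `z k = x k - G k / 2` and
`d k = x (k + 1) - x k + G k`, the iteration becomes
`z (k + 1) - z k = d k - (G k + G (k + 1)) / 2`,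
`t d (k + 1) = (t - α) d k + (α - θ) G (k + 1)` with `t = k + 1 + σ`,
and `⟨z (k + 1) - z k, G (k + 1) - G k⟩ ≥ 0` expresses that `J` is firmly nonexpansive and `s ≤ 2`.

For this recursion there is a family of energies, affine in a parameter `lam`, whose variation is an
explicit identity (`energy_sub`). For `lam` near `α - θ` the energies decrease eventually, and the
decrease controls `⟨G, z - z*⟩`, `k ‖d‖²` and `k ‖G‖²`, which are therefore summable. Two values of
`lam` suffice to see that both coefficients of the affine function converge. The constant one is of
the order of `k² (‖d‖² + ‖G‖²)`, so its limit is zero by summability, which gives the rates `o(1/k)`;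
the slope is then asymptotic to a multiple of `‖z - z*‖²`, which therefore converges
(`recursion_asymptotics`).

Weak convergence of `J (u k)` in `H` follows by Opial's argument
(`exists_weakTendsto_resolvent`): the Lipschitz assumption bounds the norm of `J u - J v` by the
seminorm of `u - v`, which yields boundedness and uniqueness of the cluster point although the
seminorm may be degenerate. For an onto decomposition `M = C C*` the map `C*` is surjective, is
isometric for the seminorm, and intertwines `J` with the resolvent of `C* ▷ A`; all statements about
`w = C* u` are thus transported from those about `u`.
-/

namespace FastKM

/-! ### Lyapunov energy of the recursion -/

section Energy
variable {E : Type*} [SeminormedAddCommGroup E] [InnerProductSpace ℝ E]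

/-- The Lyapunov function of the recursion
`z' = z + d - (G + G') / 2`, `t d' = (t - α) d + (α - θ) G'`, at the shifted time
`h = t - 1 - α / 2`. The parameter `lam` weighs the displacement `z` from the fixed point. As `d`
is close to `(z' - z) + G`, the square is to leading order that of
`lam • z + h • ((z' - z) + (1 - ε) • G)`. The shift of time and the additive constants are chosen so
that `energy_sub` is an exact identity. -/
noncomputable def energy (α θ ε lam h : ℝ) (z d G : E) : ℝ :=
  ‖lam • z + ((h + α / 2) • d - (ε * h + (α - θ) / 2) • G)‖ ^ 2 / 2
    + lam * (α - 1 - lam) / 2 * ‖z‖ ^ 2 + lam * ε * h * ⟪G, z⟫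
    + (ε * (1 - ε) * h ^ 2
      + (((α - θ) / 4 - ε / 4) * (θ - 1 + ε) - ε * (1 - ε) / 4)) / 2 * ‖G‖ ^ 2

/-- Exact variation of the energy along one step. Only the quadratic form in `z' - z` and
`(G + G') / 2` has no evident sign; by `exists_energy_parameters` it is positive definite for
suitable `ε` and `lam`. The square `‖G' - G‖ ^ 2` has the right sign because `θ < α - 1`. -/
theorem energy_sub (α θ ε lam h : ℝ) {z d G z' d' G' : E}
    (hz : z' = z + d - (1 / 2 : ℝ) • (G + G'))
    (hd : (h + 1 + α / 2) • d' = (h + 1 - α / 2) • d + (α - θ) • G') :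
    energy α θ ε lam (h + 1) z' d' G' - energy α θ ε lam h z d G =
      -(lam * (θ - 1) * ((⟪G, z⟫ + ⟪G', z'⟫) / 2))
      - (ε * (h + 1 / 2) ^ 2 + (α - 1 - lam) * ((α - θ) / 4 - ε / 4) - lam * (θ - 1 + ε) / 4)
        * ⟪z' - z, G' - G⟫
      - ε * (h + 1 / 2) * (α - θ - 1) / 4 * ‖G' - G‖ ^ 2
      - (h + 1 / 2) * ((α - 1 - lam) * ‖z' - z‖ ^ 2
        + (α - 1 - lam + (θ - 1) - ε * (α - 2)) * ⟪z' - z, (1 / 2 : ℝ) • (G + G')⟫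
        + (θ - 1) * (1 - ε) * ‖(1 / 2 : ℝ) • (G + G')‖ ^ 2) := by
  subst hz
  -- `d'` enters only through `(h + 1 + α / 2) • d'`, so `hd` eliminates it
  simp only [energy, hd, ← real_inner_self_eq_norm_sq, inner_add_left, inner_add_right,
    inner_sub_left, inner_sub_right, real_inner_smul_left, real_inner_smul_right]
  simp only [real_inner_comm z d, real_inner_comm z G, real_inner_comm z G', real_inner_comm d G,
    real_inner_comm d G', real_inner_comm G G']
  ring

theorem norm_add_sq_le (x y : E) : ‖x + y‖ ^ 2 ≤ 2 * (‖x‖ ^ 2 + ‖y‖ ^ 2) := by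
  have := norm_add_sq_real x y
  have h := norm_sub_sq_real x y
  nlinarith [sq_nonneg ‖x - y‖]

/-- A quadratic form in two vectors with negative discriminant is coercive. -/
theorem exists_pos_le_quadForm {p m r : ℝ} (hp : 0 < p) (hr : 0 < r) (h : m ^ 2 < 4 * p * r) :
    ∃ η > 0, ∀ x y : E,
      η * (‖x‖ ^ 2 + ‖y‖ ^ 2) ≤ p * ‖x‖ ^ 2 + m * ⟪x, y⟫ + r * ‖y‖ ^ 2 := by
  have hpr : 0 < 4 * (p + r) := by linarith
  obtain ⟨η, hη⟩ : ∃ η, η = (4 * p * r - m ^ 2) / (4 * (p + r)) := ⟨_, rfl⟩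
  have hη' : η * (4 * (p + r)) = 4 * p * r - m ^ 2 := by rw [hη]; field_simp
  have hη0 : 0 < η := by rw [hη]; exact div_pos (by linarith) hpr
  have hηp : 0 < p - η := by
    by_contra hc
    nlinarith [sq_nonneg m, mul_nonneg (by linarith : (0 : ℝ) ≤ η - p) hpr.le]
  refine ⟨η, hη0, fun x y => ?_⟩
  have hdet : m ^ 2 / 4 ≤ (p - η) * (r - η) := by nlinarith
  -- completing the square after multiplication by `p - η > 0`
  have hsq : 0 ≤ ‖(p - η) • x + (m / 2) • y‖ ^ 2 := sq_nonneg _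
  rw [← real_inner_self_eq_norm_sq] at hsq
  simp only [inner_add_left, inner_add_right, real_inner_smul_left, real_inner_smul_right,
    real_inner_comm x y] at hsq
  rw [real_inner_self_eq_norm_sq, real_inner_self_eq_norm_sq] at hsq
  have h2 := mul_le_mul_of_nonneg_right hdet (sq_nonneg ‖y‖)
  have h3 : 0 ≤ (p - η) * ((p - η) * ‖x‖ ^ 2 + m * ⟪x, y⟫ + (r - η) * ‖y‖ ^ 2) := by
    nlinarith
  have h4 := nonneg_of_mul_nonneg_right h3 hηp
  linarith

/-- At `lam = α - θ` the two squares of the quadratic form in `energy_sub` have weights `θ - 1` and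
`(θ - 1) (1 - ε)`, and to first order in `ε` its discriminant is negative because `θ < α - 1`. The
condition is open in `lam`, which leaves room for a second value. -/
theorem exists_energy_parameters {α θ : ℝ} (hθ : θ ∈ Set.Ioo 1 (α - 1)) :
    ∃ ε lam₀ lam₁ : ℝ, 0 < ε ∧ ε < 1 ∧ lam₀ ≠ lam₁ ∧ ∀ lam ∈ ({lam₀, lam₁} : Set ℝ),
      0 < lam ∧ lam < α - 1 ∧ (α - 1 - lam + (θ - 1) - ε * (α - 2)) ^ 2
        < 4 * (α - 1 - lam) * ((θ - 1) * (1 - ε)) := by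
  obtain ⟨h1, h2⟩ := hθ
  have hα : 0 < α - 2 := by linarith
  have hpos : 0 < 2 * (θ - 1) * (α - 1 - θ) / (α - 2) ^ 2 :=
    div_pos (mul_pos (mul_pos two_pos (by linarith)) (by linarith)) (by positivity)
  obtain ⟨ε, hε⟩ : ∃ ε, ε = min (1 / 2) (2 * (θ - 1) * (α - 1 - θ) / (α - 2) ^ 2) := ⟨_, rfl⟩
  have hε0 : 0 < ε := by rw [hε]; exact lt_min (by norm_num) hpos
  have hε1 : ε < 1 := by
    have : ε ≤ 1 / 2 := by rw [hε]; exact min_le_left _ _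
    linarith
  have hε2 : ε * (α - 2) ^ 2 ≤ 2 * (θ - 1) * (α - 1 - θ) := by
    have : ε ≤ 2 * (θ - 1) * (α - 1 - θ) / (α - 2) ^ 2 := by rw [hε]; exact min_le_right _ _
    rwa [le_div_iff₀ (by positivity)] at this
  have hP : 0 < (θ - 1) * (α - 1 - θ) := mul_pos (by linarith) (by linarith)
  -- after expansion: `ε (α - 2) ^ 2 < 4 (θ - 1) (α - 1 - θ)`
  have key : (α - 1 - (α - θ) + (θ - 1) - ε * (α - 2)) ^ 2
        < 4 * (α - 1 - (α - θ)) * ((θ - 1) * (1 - ε)) := by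
    have : ε * (ε * (α - 2) ^ 2) < ε * (4 * ((θ - 1) * (α - 1 - θ))) :=
      mul_lt_mul_of_pos_left (by linarith) hε0
    nlinarith
  have hev : ∀ᶠ lam in 𝓝 (α - θ), 0 < lam ∧ lam < α - 1 ∧
      (α - 1 - lam + (θ - 1) - ε * (α - 2)) ^ 2
        < 4 * (α - 1 - lam) * ((θ - 1) * (1 - ε)) := by
    refine (eventually_gt_nhds (by linarith)).and ((eventually_lt_nhds (by linarith)).and ?_)
    exact Continuous.tendsto (by fun_prop : Continuous fun lam : ℝ =>
      (α - 1 - lam + (θ - 1) - ε * (α - 2)) ^ 2) _ |>.eventually_lt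
      (Continuous.tendsto (by fun_prop : Continuous fun lam : ℝ =>
        4 * (α - 1 - lam) * ((θ - 1) * (1 - ε))) _) key
  obtain ⟨lam₁, hlam₁, hne⟩ :=
    ((hev.filter_mono nhdsWithin_le_nhds).and
      (self_mem_nhdsWithin : {α - θ}ᶜ ∈ 𝓝[≠] (α - θ))).exists
  refine ⟨ε, α - θ, lam₁, hε0, hε1, fun h => hne h.symm, ?_⟩
  rintro lam (rfl | rfl)
  exacts [hev.self_of_nhds, hlam₁]

theorem energy_lower_bound {α θ ε lam : ℝ} (hε : ε ∈ Set.Ioo (0 : ℝ) 1) (hlam : 0 < lam) :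
    ∀ᶠ h : ℝ in atTop, ∀ z d G : E, 0 ≤ ⟪G, z⟫ →
      lam * (α - 1 - lam) / 2 * ‖z‖ ^ 2 ≤ energy α θ ε lam h z d G := by
  have hc : 0 < ε * (1 - ε) := mul_pos hε.1 (by linarith [hε.2])
  have hev : ∀ᶠ h : ℝ in atTop, 0 ≤ ε * (1 - ε) * h ^ 2
      + (((α - θ) / 4 - ε / 4) * (θ - 1 + ε) - ε * (1 - ε) / 4) :=
    (tendsto_atTop_add_const_right _ _
      ((tendsto_pow_atTop two_ne_zero).const_mul_atTop hc)).eventually_ge_atTop 0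
  filter_upwards [hev, eventually_ge_atTop 0] with h h1 h2 z d G hg
  unfold energy
  have e1 : 0 ≤ lam * ε * h * ⟪G, z⟫ :=
    mul_nonneg (mul_nonneg (mul_nonneg hlam.le hε.1.le) h2) hg
  have e2 := mul_nonneg (div_nonneg h1 two_pos.le) (sq_nonneg ‖G‖)
  have e3 := sq_nonneg ‖lam • z + ((h + α / 2) • d - (ε * h + (α - θ) / 2) • G)‖
  linarith

/-- The energy eventually decreases, by an amount that controls all quantities to be summed. -/
theorem exists_energy_decrease {α θ ε lam : ℝ} (hθ : θ ∈ Set.Ioo 1 (α - 1))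
    (hε : ε ∈ Set.Ioo (0 : ℝ) 1) (hlam : 0 < lam) (hlam' : lam < α - 1)
    (hq : (α - 1 - lam + (θ - 1) - ε * (α - 2)) ^ 2
        < 4 * (α - 1 - lam) * ((θ - 1) * (1 - ε))) :
    ∃ η > 0, ∀ᶠ h : ℝ in atTop, ∀ z d G z' d' G' : E,
      z' = z + d - (1 / 2 : ℝ) • (G + G') →
      (h + 1 + α / 2) • d' = (h + 1 - α / 2) • d + (α - θ) • G' →
      0 ≤ ⟪z' - z, G' - G⟫ → 0 ≤ ⟪G, z⟫ → 0 ≤ ⟪G', z'⟫ →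
      η * (⟪G, z⟫ + h * ‖d‖ ^ 2 + h * ‖G‖ ^ 2) ≤
        energy α θ ε lam h z d G - energy α θ ε lam (h + 1) z' d' G' := by
  obtain ⟨h1, h2⟩ := hθ
  obtain ⟨η₁, hη₁, hη₁'⟩ := exists_pos_le_quadForm (E := E) (sub_pos.2 hlam')
    (mul_pos (sub_pos.2 h1) (sub_pos.2 hε.2)) hq
  obtain ⟨c, hc⟩ : ∃ c, c = ε * (α - θ - 1) / 4 := ⟨_, rfl⟩
  have hc0 : 0 < c := by rw [hc]; exact div_pos (mul_pos hε.1 (by linarith)) (by norm_num)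
  obtain ⟨η, hη⟩ : ∃ η, η = min (lam * (θ - 1) / 2) (min (η₁ / 4) c) := ⟨_, rfl⟩
  have hl0 : 0 < lam * (θ - 1) := mul_pos hlam (by linarith)
  have hη0 : 0 < η := by
    rw [hη]; exact lt_min (by linarith) (lt_min (by linarith) hc0)
  have i1 : η ≤ lam * (θ - 1) / 2 := hη ▸ min_le_left _ _
  have i2 : η ≤ η₁ / 4 := hη ▸ (min_le_right _ _).trans (min_le_left _ _)
  have i3 : η ≤ c := hη ▸ (min_le_right _ _).trans (min_le_right _ _)
  refine ⟨η, hη0, ?_⟩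
  have hev : ∀ᶠ h : ℝ in atTop, 0 ≤ ε * (h + 1 / 2) ^ 2
      + ((α - 1 - lam) * ((α - θ) / 4 - ε / 4) - lam * (θ - 1 + ε) / 4) :=
    (tendsto_atTop_add_const_right _ _
      (((tendsto_pow_atTop two_ne_zero).comp
        (tendsto_atTop_add_const_right _ _ tendsto_id)).const_mul_atTop
          hε.1)).eventually_ge_atTop 0
  filter_upwards [hev, eventually_ge_atTop 0] with h ha hh z d G z' d' G' hz hd hm hg hg'
  have key := energy_sub α θ ε lam h hz hd
  have hquad := hη₁' (z' - z) ((1 / 2 : ℝ) • (G + G'))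
  -- the variables in which `energy_sub` is diagonal up to the quadratic form: `d = v + w` and
  -- `G = w - δ / 2`
  obtain ⟨v, hv⟩ : ∃ v, v = z' - z := ⟨_, rfl⟩
  obtain ⟨w, hw⟩ : ∃ w, w = (1 / 2 : ℝ) • (G + G') := ⟨_, rfl⟩
  obtain ⟨δ, hδ⟩ : ∃ δ, δ = G' - G := ⟨_, rfl⟩
  have hdv : d = v + w := by rw [hv, hw, hz]; abel
  have hGw : G = w - (1 / 2 : ℝ) • δ := by rw [hw, hδ]; module
  rw [← hv, ← hw, ← hδ] at key
  rw [← hv, ← hw] at hquad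
  rw [← hv, ← hδ] at hm
  have nd : ‖d‖ ^ 2 ≤ 2 * (‖v‖ ^ 2 + ‖w‖ ^ 2) := by
    rw [hdv]; exact norm_add_sq_le v w
  have nG : ‖G‖ ^ 2 ≤ 2 * ‖w‖ ^ 2 + ‖δ‖ ^ 2 / 2 := by
    have e : ‖-((1 / 2 : ℝ) • δ)‖ = 1 / 2 * ‖δ‖ := by rw [norm_neg, norm_smul]; norm_num
    have := norm_add_sq_le w (-((1 / 2 : ℝ) • δ))
    rw [e, ← sub_eq_add_neg, ← hGw] at this
    linarith
  have t1 := mul_nonneg ha hm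
  have t2 : lam * (θ - 1) / 2 * ⟪G, z⟫ ≤ lam * (θ - 1) * ((⟪G, z⟫ + ⟪G', z'⟫) / 2) := by
    have := mul_nonneg hl0.le hg'
    linarith
  have t3 : η * ⟪G, z⟫ ≤ lam * (θ - 1) / 2 * ⟪G, z⟫ := mul_le_mul_of_nonneg_right i1 hg
  have t4 := mul_le_mul_of_nonneg_left hquad (by linarith : (0 : ℝ) ≤ h + 1 / 2)
  have s1 : 0 ≤ ‖v‖ ^ 2 + ‖w‖ ^ 2 := by positivity
  have s2 : 0 ≤ ‖δ‖ ^ 2 := by positivity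
  have t5 : η * (h * ‖d‖ ^ 2 + h * ‖G‖ ^ 2) ≤
      η * (h * (4 * (‖v‖ ^ 2 + ‖w‖ ^ 2) + ‖δ‖ ^ 2)) := by
    have : ‖d‖ ^ 2 + ‖G‖ ^ 2 ≤ 4 * (‖v‖ ^ 2 + ‖w‖ ^ 2) + ‖δ‖ ^ 2 := by
      have := sq_nonneg ‖v‖
      linarith
    rw [← mul_add]
    exact mul_le_mul_of_nonneg_left (mul_le_mul_of_nonneg_left this hh) hη0.le
  have t6 : η * (h * (4 * (‖v‖ ^ 2 + ‖w‖ ^ 2))) ≤ (h + 1 / 2) * (η₁ * (‖v‖ ^ 2 + ‖w‖ ^ 2)) := by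
    have a1 := mul_le_mul_of_nonneg_right i2 (mul_nonneg hh s1)
    have a2 := mul_nonneg hη₁.le s1
    linarith
  have t7 : η * (h * ‖δ‖ ^ 2) ≤ ε * (h + 1 / 2) * (α - θ - 1) / 4 * ‖δ‖ ^ 2 := by
    have a1 := mul_le_mul_of_nonneg_right i3 (mul_nonneg hh s2)
    have a2 : ε * (h + 1 / 2) * (α - θ - 1) / 4 * ‖δ‖ ^ 2
        = c * (h * ‖δ‖ ^ 2) + c * ‖δ‖ ^ 2 / 2 := by rw [hc]; ring
    have a3 := mul_nonneg hc0.le s2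
    rw [a2]; linarith
  linarith

end Energy

/-! ### Real sequences -/

section RealSequences

theorem summable_and_tendsto_of_le_sub {a e : ℕ → ℝ} (ha : ∀ᶠ k in atTop, 0 ≤ a k)
    (he : ∀ᶠ k in atTop, 0 ≤ e k) (h : ∀ᶠ k in atTop, a k ≤ e k - e (k + 1)) :
    Summable a ∧ ∃ l, Tendsto e atTop (𝓝 l) := by
  obtain ⟨N, hN⟩ := eventually_atTop.1 (ha.and (he.and h))
  have hshift : ∀ k, 0 ≤ a (k + N) ∧ 0 ≤ e (k + N) ∧ a (k + N) ≤ e (k + N) - e (k + 1 + N) := by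
    intro k
    have := hN (k + N) (by omega)
    rwa [show k + N + 1 = k + 1 + N by omega] at this
  have hanti : Antitone fun k => e (k + N) := antitone_nat_of_succ_le fun k => by
    have := hshift k
    linarith [this.1, this.2.2]
  refine ⟨(summable_nat_add_iff N).1 ?_, ?_⟩
  · refine summable_of_sum_range_le (c := e (0 + N)) (fun k => (hshift k).1) fun n => ?_
    have : ∑ i ∈ Finset.range n, a (i + N) ≤ e (0 + N) - e (n + N) := by
      rw [← Finset.sum_range_sub' (fun k => e (k + N))]
      exact Finset.sum_le_sum fun i _ => (hshift i).2.2
    linarith [(hshift n).2.1]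
  · refine ⟨_, (tendsto_add_atTop_iff_nat N).1 (tendsto_atTop_ciInf hanti ⟨0, ?_⟩)⟩
    rintro _ ⟨k, rfl⟩
    exact (hshift k).2.1

/-- If `A k ≤ c k r k` with `r` summable, then a positive limit of `A` would make the harmonic
series converge. -/
theorem limit_eq_zero_of_le_mul_summable {A r : ℕ → ℝ} {c l : ℝ} (hA : Tendsto A atTop (𝓝 l))
    (hA0 : ∀ᶠ k in atTop, 0 ≤ A k) (hr : Summable r)
    (h : ∀ᶠ k : ℕ in atTop, A k ≤ c * (k * r k)) : l = 0 := by
  by_contra hl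
  have hl0 : 0 < l := lt_of_le_of_ne (ge_of_tendsto hA hA0) (Ne.symm hl)
  refine Real.not_summable_natCast_inv ?_
  refine Summable.of_norm_bounded_eventually_nat (g := fun k => 2 / l * c * r k)
    (hr.mul_left _) ?_
  filter_upwards [h, hA.eventually_const_le (by linarith : l / 2 < l), eventually_gt_atTop 0]
    with k h1 h2 h3
  have hk : (0 : ℝ) < k := by exact_mod_cast h3
  rw [Real.norm_of_nonneg (by positivity), inv_le_iff_one_le_mul₀ hk]
  have : 2 / l * (l / 2) ≤ 2 / l * (c * (k * r k)) :=
    mul_le_mul_of_nonneg_left (h2.trans h1) (by positivity)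
  rw [div_mul_div_cancel₀' two_ne_zero, div_self hl] at this
  linarith

theorem isLittleO_natCast_inv {f : ℕ → ℝ} (h : Tendsto (fun k : ℕ => (k : ℝ) * f k) atTop (𝓝 0)) :
    f =o[atTop] fun k : ℕ => (k : ℝ)⁻¹ := by
  refine (isLittleO_iff_tendsto' ?_).2 (h.congr fun k => ?_)
  · filter_upwards [eventually_gt_atTop 0] with k hk h0
    exact absurd h0 (inv_ne_zero (Nat.cast_ne_zero.2 hk.ne'))
  · rw [div_inv_eq_mul, mul_comm]

theorem summable_succ_mul {a : ℕ → ℝ} (ha : ∀ k, 0 ≤ a k)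
    (h : Summable fun k : ℕ => (k : ℝ) * a k) :
    Summable fun k : ℕ => ((k + 1 : ℕ) : ℝ) * a k := by
  refine Summable.of_norm_bounded_eventually_nat (h.mul_left 2) ?_
  filter_upwards [eventually_ge_atTop 1] with k hk
  have hk' : (1 : ℝ) ≤ k := by exact_mod_cast hk
  rw [Real.norm_of_nonneg (mul_nonneg (Nat.cast_nonneg _) (ha k))]
  push_cast
  have := mul_le_mul_of_nonneg_right hk' (ha k)
  linarith

theorem tendsto_zero_of_natCast_mul {a : ℕ → ℝ} (ha : ∀ k, 0 ≤ a k)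
    (h : Tendsto (fun k : ℕ => (k : ℝ) * a k) atTop (𝓝 0)) : Tendsto a atTop (𝓝 0) := by
  refine squeeze_zero' (Eventually.of_forall ha) ?_ h
  filter_upwards [eventually_ge_atTop 1] with k hk
  exact le_mul_of_one_le_left (ha k) (by exact_mod_cast hk)

theorem tendsto_succ_mul {a : ℕ → ℝ} (ha : ∀ k, 0 ≤ a k)
    (h : Tendsto (fun k : ℕ => (k : ℝ) * a k) atTop (𝓝 0)) :
    Tendsto (fun k : ℕ => ((k + 1 : ℕ) : ℝ) * a k) atTop (𝓝 0) := by
  have := h.add (tendsto_zero_of_natCast_mul ha h)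
  rw [add_zero] at this
  refine this.congr fun k => ?_
  push_cast
  ring

end RealSequences

/-! ### Asymptotics of the iteration -/

section Energy
variable {E : Type*} [SeminormedAddCommGroup E] [InnerProductSpace ℝ E]

/-- The part of `energy` that does not depend on `lam`; it is of the order of
`h ^ 2 * (‖d‖ ^ 2 + ‖G‖ ^ 2)` (`exists_energyConst_bounds`). -/
noncomputable def energyConst (α θ ε h : ℝ) (d G : E) : ℝ :=
  ‖(h + α / 2) • d - (ε * h + (α - θ) / 2) • G‖ ^ 2 / 2
    + (ε * (1 - ε) * h ^ 2
      + (((α - θ) / 4 - ε / 4) * (θ - 1 + ε) - ε * (1 - ε) / 4)) / 2 * ‖G‖ ^ 2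

/-- The coefficient of `lam` in `energy`, which is affine in `lam`; it is independent of `ε`. -/
noncomputable def energySlope (α θ h : ℝ) (z d G : E) : ℝ :=
  ⟪z, (h + α / 2) • d - ((α - θ) / 2) • G⟫ + (α - 1) / 2 * ‖z‖ ^ 2

theorem energy_eq (α θ ε lam h : ℝ) (z d G : E) :
    energy α θ ε lam h z d G = energyConst α θ ε h d G + lam * energySlope α θ h z d G := by
  simp only [energy, energyConst, energySlope, ← real_inner_self_eq_norm_sq, inner_add_left,
    inner_add_right, inner_sub_left, inner_sub_right, real_inner_smul_left, real_inner_smul_right]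
  simp only [real_inner_comm z d, real_inner_comm z G, real_inner_comm d G]
  ring

theorem norm_sub_sq_le (x y : E) : ‖x - y‖ ^ 2 ≤ 2 * (‖x‖ ^ 2 + ‖y‖ ^ 2) := by
  simpa [sub_eq_add_neg] using norm_add_sq_le x (-y)

theorem norm_smul_sq (c : ℝ) (x : E) : ‖c • x‖ ^ 2 = c ^ 2 * ‖x‖ ^ 2 := by
  rw [norm_smul, mul_pow, Real.norm_eq_abs, sq_abs]

theorem exists_energyConst_bounds {α θ ε : ℝ} (hα : 0 < α) (hε : ε ∈ Set.Ioo (0 : ℝ) 1) :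
    ∃ c K : ℝ, ∀ᶠ h : ℝ in atTop, ∀ d G : E, 0 ≤ energyConst α θ ε h d G ∧
      energyConst α θ ε h d G ≤ c * (h ^ 2 * (‖d‖ ^ 2 + ‖G‖ ^ 2)) ∧
      h ^ 2 * (‖d‖ ^ 2 + ‖G‖ ^ 2) ≤ K * energyConst α θ ε h d G := by
  obtain ⟨m, hm⟩ : ∃ m, m = ((α - θ) / 4 - ε / 4) * (θ - 1 + ε) - ε * (1 - ε) / 4 := ⟨_, rfl⟩
  obtain ⟨κ, hκ⟩ : ∃ κ, κ = ε * (1 - ε) := ⟨_, rfl⟩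
  have hκ0 : 0 < κ := by rw [hκ]; exact mul_pos hε.1 (by linarith [hε.2])
  refine ⟨8 + κ, 4 + 36 / κ, ?_⟩
  have hsq : Tendsto (fun h : ℝ => h ^ 2) atTop atTop := tendsto_pow_atTop two_ne_zero
  filter_upwards [eventually_ge_atTop (α / 2), eventually_ge_atTop 0,
    (hsq.const_mul_atTop hκ0).eventually_ge_atTop m,
    (hsq.const_mul_atTop (by linarith : 0 < κ / 2)).eventually_ge_atTop (-m),
    (tendsto_id.const_mul_atTop (by linarith [hε.2] : 0 < 2 - ε)).eventually_ge_atTop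
      ((α - θ) / 2),
    (tendsto_id.const_mul_atTop hε.1).eventually_ge_atTop (-((α - θ) / 2))]
    with h h1 h2 h3 h4 h5 h6 d G
  simp only [id] at h5 h6
  obtain ⟨q, hq⟩ : ∃ q, q = ε * h + (α - θ) / 2 := ⟨_, rfl⟩
  have hq2 : q ^ 2 ≤ 4 * h ^ 2 := by
    have : q ^ 2 ≤ (2 * h) ^ 2 := pow_le_pow_left₀ (by linarith) (by linarith) 2
    linarith
  unfold energyConst
  rw [← hm, ← hκ, ← hq]
  have e0 := sq_nonneg ‖(h + α / 2) • d - q • G‖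
  have eD := norm_sub_sq_le ((h + α / 2) • d) (q • G)
  have eD' := norm_add_sq_le ((h + α / 2) • d - q • G) (q • G)
  rw [sub_add_cancel] at eD'
  rw [norm_smul_sq, norm_smul_sq] at eD eD'
  have sG := sq_nonneg ‖G‖
  have sd := sq_nonneg ‖d‖
  have a1 : (h + α / 2) ^ 2 ≤ 4 * h ^ 2 := by
    have : (h + α / 2) ^ 2 ≤ (2 * h) ^ 2 := pow_le_pow_left₀ (by linarith) (by linarith) 2
    linarith
  have a2 : h ^ 2 ≤ (h + α / 2) ^ 2 := pow_le_pow_left₀ h2 (by linarith) 2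
  have b1 := mul_le_mul_of_nonneg_right a1 sd
  have b2 := mul_le_mul_of_nonneg_right a2 sd
  have b3 := mul_le_mul_of_nonneg_right hq2 sG
  have b4 : (κ * h ^ 2 + m) / 2 * ‖G‖ ^ 2 ≤ κ * h ^ 2 * ‖G‖ ^ 2 :=
    mul_le_mul_of_nonneg_right (by linarith) sG
  have b5 : κ / 4 * h ^ 2 * ‖G‖ ^ 2 ≤ (κ * h ^ 2 + m) / 2 * ‖G‖ ^ 2 :=
    mul_le_mul_of_nonneg_right (by linarith) sG
  have b6 : 0 ≤ κ / 4 * h ^ 2 * ‖G‖ ^ 2 := by positivity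
  have b7 : 0 ≤ κ * (h ^ 2 * ‖d‖ ^ 2) := by positivity
  have b8 : 0 ≤ h ^ 2 * ‖d‖ ^ 2 := by positivity
  have b9 : 0 ≤ h ^ 2 * ‖G‖ ^ 2 := by positivity
  refine ⟨by linarith, by linarith, ?_⟩
  have b10 : 36 / κ * (κ / 4 * h ^ 2 * ‖G‖ ^ 2) = 9 * (h ^ 2 * ‖G‖ ^ 2) := by
    field_simp; ring
  have b11 : 36 / κ * (κ / 4 * h ^ 2 * ‖G‖ ^ 2) ≤ 36 / κ *
      (‖(h + α / 2) • d - q • G‖ ^ 2 / 2 + (κ * h ^ 2 + m) / 2 * ‖G‖ ^ 2) :=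
    mul_le_mul_of_nonneg_left (by linarith) (by positivity)
  rw [add_mul]
  linarith

/-- Asymptotics of the recursion in the variables `z`, `d`, `G`, by comparing the energies for two
values of `lam`. No operator is involved: only monotonicity of `G` along the sequence and towards
the reference point, which is placed at the origin. -/
theorem recursion_asymptotics {α θ σ : ℝ} (hθ : θ ∈ Set.Ioo 1 (α - 1)) {z d G : ℕ → E}
    (hz : ∀ k, z (k + 1) = z k + d k - (1 / 2 : ℝ) • (G k + G (k + 1)))
    (hd : ∀ k : ℕ, (k + 1 + σ) • d (k + 1) = (k + 1 + σ - α) • d k + (α - θ) • G (k + 1))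
    (hmono : ∀ k, 0 ≤ ⟪z (k + 1) - z k, G (k + 1) - G k⟫) (hpos : ∀ k, 0 ≤ ⟪G k, z k⟫) :
    Summable (fun k => ⟪G k, z k⟫) ∧ Summable (fun k : ℕ => (k : ℝ) * ‖G k‖ ^ 2) ∧
    Summable (fun k : ℕ => (k : ℝ) * ‖d k‖ ^ 2) ∧
    Tendsto (fun k : ℕ => (k : ℝ) * ‖G k‖) atTop (𝓝 0) ∧
    Tendsto (fun k : ℕ => (k : ℝ) * ‖d k‖) atTop (𝓝 0) ∧
    ∃ l, Tendsto (fun k => ‖z k‖ ^ 2) atTop (𝓝 l) := by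
  have hα : 2 < α := by linarith [hθ.1, hθ.2]
  obtain ⟨ε, lam₀, lam₁, hε0, hε1, hne, hlam⟩ := exists_energy_parameters hθ
  have hε : ε ∈ Set.Ioo (0 : ℝ) 1 := ⟨hε0, hε1⟩
  -- the shifted time: `t = k + 1 + σ` is `h k + 1 + α / 2`
  obtain ⟨h, hh⟩ : ∃ h : ℕ → ℝ, ∀ k, h k = k + (σ - α / 2) := ⟨_, fun _ => rfl⟩
  have hhtop : Tendsto h atTop atTop := by
    rw [funext hh]
    exact tendsto_atTop_add_const_right _ _ tendsto_natCast_atTop_atTop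
  have hhk : ∀ᶠ k : ℕ in atTop, (k : ℝ) ≤ 2 * h k ∧ h k ≤ 2 * k ∧ 1 ≤ h k := by
    have hN := tendsto_natCast_atTop_atTop (R := ℝ)
    filter_upwards [hN.eventually_ge_atTop (-2 * (σ - α / 2)),
      hN.eventually_ge_atTop (σ - α / 2), hhtop.eventually_ge_atTop 1] with k h1 h2 h3
    refine ⟨?_, ?_, h3⟩ <;> rw [hh] <;> linarith
  have hstep : ∀ lam ∈ ({lam₀, lam₁} : Set ℝ),
      (∃ η > 0, Summable (fun k => η * (⟪G k, z k⟫ + h k * ‖d k‖ ^ 2 + h k * ‖G k‖ ^ 2))) ∧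
      (∃ l, Tendsto (fun k => energy α θ ε lam (h k) (z k) (d k) (G k)) atTop (𝓝 l)) ∧
      ∀ᶠ k in atTop, lam * (α - 1 - lam) / 2 * ‖z k‖ ^ 2
        ≤ energy α θ ε lam (h k) (z k) (d k) (G k) := by
    intro lam hl
    obtain ⟨l0, l1, l2⟩ := hlam lam hl
    obtain ⟨η, hη, hdec⟩ := exists_energy_decrease (E := E) hθ hε l0 l1 l2
    have hlow : ∀ᶠ k in atTop, lam * (α - 1 - lam) / 2 * ‖z k‖ ^ 2
        ≤ energy α θ ε lam (h k) (z k) (d k) (G k) := by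
      filter_upwards [hhtop.eventually (energy_lower_bound (E := E) (θ := θ) (α := α) hε l0)]
        with k hk using hk _ _ _ (hpos k)
    have := summable_and_tendsto_of_le_sub
      (a := fun k => η * (⟪G k, z k⟫ + h k * ‖d k‖ ^ 2 + h k * ‖G k‖ ^ 2))
      (e := fun k => energy α θ ε lam (h k) (z k) (d k) (G k)) ?_ ?_ ?_
    · exact ⟨⟨η, hη, this.1⟩, this.2, hlow⟩
    · filter_upwards [hhk] with k hk
      have := hpos k
      have h0 : 0 ≤ h k := by linarith
      positivity
    · filter_upwards [hlow] with k hk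
      have : 0 < α - 1 - lam := by linarith
      exact le_trans (by positivity) hk
    · filter_upwards [hhtop.eventually hdec] with k hk
      have e1 : h (k + 1) = h k + 1 := by rw [hh, hh]; push_cast; ring
      rw [e1]
      refine hk _ _ _ _ _ _ (hz k) ?_ (hmono k) (hpos k) (hpos (k + 1))
      have := hd k
      rw [show h k + 1 + α / 2 = (k : ℝ) + 1 + σ by rw [hh]; ring,
        show h k + 1 - α / 2 = (k : ℝ) + 1 + σ - α by rw [hh]; ring]
      exact this
  obtain ⟨⟨η, hη, hsum⟩, ⟨l₀, hl₀⟩, hlow⟩ := hstep lam₀ (by simp)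
  obtain ⟨-, ⟨l₁, hl₁⟩, -⟩ := hstep lam₁ (by simp)
  have hsum' : Summable (fun k => ⟪G k, z k⟫ + h k * ‖d k‖ ^ 2 + h k * ‖G k‖ ^ 2) :=
    (summable_mul_left_iff hη.ne').1 hsum
  -- the three summands are nonnegative for large `k`, and `k ≤ 2 h k`
  have hS : Summable (fun k => ⟪G k, z k⟫) := by
    refine Summable.of_norm_bounded_eventually_nat hsum' ?_
    filter_upwards [hhk] with k hk
    have h0 : 0 ≤ h k := by linarith
    have a1 := mul_nonneg h0 (sq_nonneg ‖d k‖)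
    have a2 := mul_nonneg h0 (sq_nonneg ‖G k‖)
    rw [Real.norm_of_nonneg (hpos k)]
    linarith
  have hSG : Summable (fun k : ℕ => (k : ℝ) * ‖G k‖ ^ 2) := by
    refine Summable.of_norm_bounded_eventually_nat (hsum'.mul_left 2) ?_
    filter_upwards [hhk] with k hk
    have h0 : 0 ≤ h k := by linarith
    have a1 := mul_nonneg h0 (sq_nonneg ‖d k‖)
    have a2 := mul_le_mul_of_nonneg_right hk.1 (sq_nonneg ‖G k‖)
    rw [Real.norm_of_nonneg (by positivity)]
    linarith [hpos k]
  have hSd : Summable (fun k : ℕ => (k : ℝ) * ‖d k‖ ^ 2) := by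
    refine Summable.of_norm_bounded_eventually_nat (hsum'.mul_left 2) ?_
    filter_upwards [hhk] with k hk
    have h0 : 0 ≤ h k := by linarith
    have a1 := mul_nonneg h0 (sq_nonneg ‖G k‖)
    have a2 := mul_le_mul_of_nonneg_right hk.1 (sq_nonneg ‖d k‖)
    rw [Real.norm_of_nonneg (by positivity)]
    linarith [hpos k]
  -- the energies are affine in `lam`, so that both coefficients converge
  have hdiff : lam₁ - lam₀ ≠ 0 := sub_ne_zero.2 hne.symm
  have hslope : Tendsto (fun k => energySlope α θ (h k) (z k) (d k) (G k)) atTop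
      (𝓝 ((l₁ - l₀) / (lam₁ - lam₀))) := by
    refine ((hl₁.sub hl₀).div_const _).congr fun k => ?_
    rw [energy_eq, energy_eq]
    field_simp
    ring
  obtain ⟨lA, hlA⟩ : ∃ lA, Tendsto (fun k => energyConst α θ ε (h k) (d k) (G k)) atTop
      (𝓝 lA) := by
    refine ⟨_, (hl₀.sub (hslope.const_mul lam₀)).congr fun k => ?_⟩
    rw [energy_eq]
    ring
  obtain ⟨c, K, hcK⟩ := exists_energyConst_bounds (E := E) (θ := θ) (by linarith : 0 < α) hε
  have hA := hhtop.eventually hcK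
  have hlA0 : lA = 0 := by
    refine limit_eq_zero_of_le_mul_summable (c := 4 * |c|) hlA (hA.mono fun k hk => (hk _ _).1)
      (hSd.add hSG) ?_
    filter_upwards [hA, hhk] with k hk1 hk2
    have h0 : 0 ≤ h k := by linarith
    have a1 := (hk1 (d k) (G k)).2.1
    have a2 : h k ^ 2 ≤ 4 * (k : ℝ) ^ 2 := by
      have : h k ^ 2 ≤ (2 * (k : ℝ)) ^ 2 := pow_le_pow_left₀ h0 hk2.2.1 2
      linarith
    have a3 : 0 ≤ ‖d k‖ ^ 2 + ‖G k‖ ^ 2 := by positivity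
    have a4 := mul_le_mul_of_nonneg_right a2 a3
    have a5 : c * (h k ^ 2 * (‖d k‖ ^ 2 + ‖G k‖ ^ 2))
        ≤ |c| * (h k ^ 2 * (‖d k‖ ^ 2 + ‖G k‖ ^ 2)) :=
      mul_le_mul_of_nonneg_right (le_abs_self c) (by positivity)
    have a6 := mul_le_mul_of_nonneg_left a4 (abs_nonneg c)
    linarith
  rw [hlA0] at hlA
  have hQ : Tendsto (fun k : ℕ => (k : ℝ) ^ 2 * (‖d k‖ ^ 2 + ‖G k‖ ^ 2)) atTop (𝓝 0) := by
    have hb : Tendsto (fun k => 4 * (K * energyConst α θ ε (h k) (d k) (G k))) atTop (𝓝 0) := by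
      simpa using (hlA.const_mul K).const_mul 4
    refine tendsto_of_tendsto_of_tendsto_of_le_of_le' tendsto_const_nhds hb
      (Eventually.of_forall fun k => by positivity) ?_
    filter_upwards [hA, hhk] with k hk1 hk2
    have a2 : (k : ℝ) ^ 2 ≤ 4 * h k ^ 2 := by
      have : (k : ℝ) ^ 2 ≤ (2 * h k) ^ 2 := pow_le_pow_left₀ (Nat.cast_nonneg k) hk2.1 2
      linarith
    have a3 : 0 ≤ ‖d k‖ ^ 2 + ‖G k‖ ^ 2 := by positivity
    have a4 := mul_le_mul_of_nonneg_right a2 a3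
    have := (hk1 (d k) (G k)).2.2
    linarith
  have hQs : Tendsto (fun k : ℕ => √((k : ℝ) ^ 2 * (‖d k‖ ^ 2 + ‖G k‖ ^ 2))) atTop (𝓝 0) := by
    simpa using hQ.sqrt
  have hkG : Tendsto (fun k : ℕ => (k : ℝ) * ‖G k‖) atTop (𝓝 0) := by
    refine squeeze_zero (fun k => by positivity) (fun k => Real.le_sqrt_of_sq_le ?_) hQs
    rw [mul_pow]
    exact mul_le_mul_of_nonneg_left (by linarith [sq_nonneg ‖d k‖]) (by positivity)
  have hkd : Tendsto (fun k : ℕ => (k : ℝ) * ‖d k‖) atTop (𝓝 0) := by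
    refine squeeze_zero (fun k => by positivity) (fun k => Real.le_sqrt_of_sq_le ?_) hQs
    rw [mul_pow]
    exact mul_le_mul_of_nonneg_left (by linarith [sq_nonneg ‖G k‖]) (by positivity)
  refine ⟨hS, hSG, hSd, hkG, hkd, ?_⟩
  -- the inner product in the slope vanishes in the limit, as `z` is bounded
  obtain ⟨R, hR⟩ : ∃ R, ∀ᶠ k in atTop, ‖z k‖ ≤ R := by
    obtain ⟨p0, p1, -⟩ := hlam lam₀ (by simp)
    have hp : 0 < lam₀ * (α - 1 - lam₀) / 2 := by
      have : 0 < α - 1 - lam₀ := by linarith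
      positivity
    refine ⟨√((l₀ + 1) / (lam₀ * (α - 1 - lam₀) / 2)), ?_⟩
    filter_upwards [hlow, hl₀.eventually_le_const (by linarith : l₀ < l₀ + 1)] with k h1 h2
    refine Real.le_sqrt_of_sq_le ?_
    rw [le_div_iff₀ hp]
    linarith
  have hinner : Tendsto (fun k => ⟪z k, (h k + α / 2) • d k - ((α - θ) / 2) • G k⟫) atTop
      (𝓝 0) := by
    have hb : Tendsto (fun k : ℕ => |R| * ((2 + α) * ((k : ℝ) * ‖d k‖)
        + |(α - θ) / 2| * ((k : ℝ) * ‖G k‖))) atTop (𝓝 0) := by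
      simpa using ((hkd.const_mul (2 + α)).add (hkG.const_mul _)).const_mul |R|
    refine squeeze_zero_norm' ?_ hb
    filter_upwards [hR, hhk, eventually_ge_atTop 1] with k h1 h2 h3
    have hk1 : (1 : ℝ) ≤ k := by exact_mod_cast h3
    refine (norm_inner_le_norm _ _).trans ?_
    refine mul_le_mul (h1.trans (le_abs_self R)) ((norm_sub_le _ _).trans ?_) (norm_nonneg _)
      (abs_nonneg R)
    rw [norm_smul, norm_smul, Real.norm_eq_abs, Real.norm_eq_abs,
      abs_of_nonneg (by linarith : 0 ≤ h k + α / 2)]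
    refine add_le_add ?_ (mul_le_mul_of_nonneg_left ?_ (abs_nonneg _))
    · have : h k + α / 2 ≤ (2 + α) * k := by nlinarith
      calc _ ≤ (2 + α) * k * ‖d k‖ := mul_le_mul_of_nonneg_right this (norm_nonneg _)
        _ = _ := by ring
    · exact le_mul_of_one_le_left (norm_nonneg _) hk1
  refine ⟨_, ((hslope.sub hinner).div_const ((α - 1) / 2)).congr fun k => ?_⟩
  rw [energySlope, add_sub_cancel_left]
  have : (α - 1) / 2 ≠ 0 := (by linarith : 0 < (α - 1) / 2).ne'
  rw [mul_div_cancel_left₀ _ this]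

end Energy

section Iteration
variable {E : Type*} [SeminormedAddCommGroup E] [InnerProductSpace ℝ E]

/-- Asymptotics of the fast Krasnoselskii–Mann iteration of `(1 - s) I + s J`, for `J` firmly
nonexpansive; `j k` stands for `J (x k)` and `y` for a fixed point. The constraint `s ≤ 2` makes
`G = s (I - J)` monotone relative to the points `z = x - G / 2`, and in these variables the
iteration is the recursion of `recursion_asymptotics`. -/
theorem fastKM_asymptotics {α θ σ s : ℝ} (hs : s ∈ Set.Ioc 0 2) (hθ : θ ∈ Set.Ioo 1 (α - 1))
    (hσ : 0 < σ) {x j : ℕ → E} {y : E}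
    (hx : ∀ k : ℕ, x (k + 2) = x (k + 1)
      + (θ / (k + 1 + σ)) • ((1 - s) • x (k + 1) + s • j (k + 1) - x (k + 1))
      + (1 - α / (k + 1 + σ)) • ((1 - s) • x (k + 1) + s • j (k + 1) - ((1 - s) • x k + s • j k)))
    (hfirm : ∀ k, 0 ≤ ⟪j (k + 1) - j k, (x (k + 1) - j (k + 1)) - (x k - j k)⟫)
    (hfix : ∀ k, 0 ≤ ⟪x k - j k, j k - y⟫) :
    Summable (fun k => ⟪x k - j k, j k - y⟫) ∧
    Summable (fun k : ℕ => (k : ℝ) * ‖x k - j k‖ ^ 2) ∧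
    Summable (fun k : ℕ => (k : ℝ) * ‖x (k + 1) - x k‖ ^ 2) ∧
    Tendsto (fun k : ℕ => (k : ℝ) * ⟪x k - j k, j k - y⟫) atTop (𝓝 0) ∧
    Tendsto (fun k : ℕ => (k : ℝ) * ‖x k - j k‖) atTop (𝓝 0) ∧
    Tendsto (fun k : ℕ => (k : ℝ) * ‖x (k + 1) - x k‖) atTop (𝓝 0) ∧
    ∃ l, Tendsto (fun k => ‖x k - y‖ ^ 2) atTop (𝓝 l) := by
  obtain ⟨hs0, hs2⟩ := hs
  have hs' : 0 ≤ s * (1 - s / 2) := mul_nonneg hs0.le (by linarith)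
  obtain ⟨G, hG⟩ : ∃ G : ℕ → E, ∀ k, G k = s • (x k - j k) := ⟨_, fun _ => rfl⟩
  obtain ⟨z, hz⟩ : ∃ z : ℕ → E, ∀ k, z k = x k - y - (1 / 2 : ℝ) • G k := ⟨_, fun _ => rfl⟩
  obtain ⟨d, hd⟩ : ∃ d : ℕ → E, ∀ k, d k = x (k + 1) - x k + G k := ⟨_, fun _ => rfl⟩
  have hGz : ∀ k, ⟪G k, z k⟫ = s * ⟪x k - j k, j k - y⟫ + s * (1 - s / 2) * ‖x k - j k‖ ^ 2 := by
    intro k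
    have : z k = (j k - y) + (1 - s / 2) • (x k - j k) := by rw [hz, hG]; module
    rw [this, hG, inner_add_right, real_inner_smul_left, real_inner_smul_left,
      real_inner_smul_right, real_inner_self_eq_norm_sq]
    ring
  obtain ⟨h1, h2, h3, h4, h5, l, h6⟩ := recursion_asymptotics (σ := σ) hθ (z := z) (d := d) (G := G)
    (fun k => by rw [hz, hz, hd]; module)
    (fun k => by
      have ht : (k : ℝ) + 1 + σ ≠ 0 := by positivity
      have e1 : ((k : ℝ) + 1 + σ) * (θ / (k + 1 + σ)) = θ := mul_div_cancel₀ _ ht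
      have e2 : ((k : ℝ) + 1 + σ) * (1 - α / (k + 1 + σ)) = k + 1 + σ - α := by
        rw [mul_sub, mul_one, mul_div_cancel₀ _ ht]
      have := congrArg (fun v => ((k : ℝ) + 1 + σ) • v) (hx k)
      simp only [smul_add, smul_smul ((k : ℝ) + 1 + σ), e1, e2] at this
      rw [hd, hd, smul_add, smul_sub, this, hG, hG]
      module)
    (fun k => by
      have e1 : z (k + 1) - z k = (j (k + 1) - j k)
          + (1 - s / 2) • ((x (k + 1) - j (k + 1)) - (x k - j k)) := by
        rw [hz, hz, hG, hG]; module
      have e2 : G (k + 1) - G k = s • ((x (k + 1) - j (k + 1)) - (x k - j k)) := by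
        rw [hG, hG]; module
      rw [e1, e2, inner_add_left, real_inner_smul_right, real_inner_smul_right,
        real_inner_smul_left, real_inner_self_eq_norm_sq]
      have a1 := mul_nonneg hs0.le (hfirm k)
      have a2 := mul_nonneg hs' (sq_nonneg ‖(x (k + 1) - j (k + 1)) - (x k - j k)‖)
      linarith)
    (fun k => by
      rw [hGz]
      exact add_nonneg (mul_nonneg hs0.le (hfix k)) (mul_nonneg hs' (sq_nonneg _)))
  have hGn : ∀ k, ‖G k‖ = s * ‖x k - j k‖ := fun k => by
    rw [hG, norm_smul, Real.norm_of_nonneg hs0.le]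
  have hkr : Tendsto (fun k : ℕ => (k : ℝ) * ‖x k - j k‖) atTop (𝓝 0) := by
    have := h4.const_mul s⁻¹
    rw [mul_zero] at this
    refine this.congr fun k => ?_
    rw [hGn]; field_simp
  have hr : Tendsto (fun k : ℕ => ‖x k - j k‖) atTop (𝓝 0) := by
    refine squeeze_zero' (Eventually.of_forall fun k => norm_nonneg _) ?_ hkr
    filter_upwards [eventually_ge_atTop 1] with k hk
    exact le_mul_of_one_le_left (norm_nonneg _) (by exact_mod_cast hk)
  have hv : ∀ k, x (k + 1) - x k = d k - G k := fun k => by rw [hd]; abel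
  have hl : Tendsto (fun k => ‖x k - y‖ ^ 2) atTop (𝓝 l) := by
    have hlim := (h6.add h1.tendsto_atTop_zero).add ((hr.pow 2).const_mul (s ^ 2 / 4))
    rw [add_zero, zero_pow two_ne_zero, mul_zero, add_zero] at hlim
    refine hlim.congr fun k => ?_
    have : x k - y = z k + (1 / 2 : ℝ) • G k := by rw [hz]; abel
    rw [this, norm_add_sq_real, norm_smul_sq, real_inner_smul_right, real_inner_comm, hGn]
    ring
  refine ⟨?_, ?_, ?_, ?_, hkr, ?_, l, hl⟩
  · refine Summable.of_nonneg_of_le hfix (fun k => ?_) (h1.mul_left s⁻¹)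
    rw [hGz, mul_add, inv_mul_cancel_left₀ hs0.ne']
    have := mul_nonneg hs' (sq_nonneg ‖x k - j k‖)
    have := mul_nonneg (inv_nonneg.2 hs0.le) this
    linarith
  · refine (h2.mul_left (s ^ 2)⁻¹).congr fun k => ?_
    rw [hGn]; field_simp
  · refine Summable.of_nonneg_of_le (fun k => by positivity) (fun k => ?_)
      ((h3.add h2).mul_left 2)
    have := mul_le_mul_of_nonneg_left (norm_sub_sq_le (d k) (G k)) (Nat.cast_nonneg (α := ℝ) k)
    rw [hv]
    linarith
  · have a1 : Tendsto (fun k => ‖x k - y‖) atTop (𝓝 (√l)) := by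
      refine hl.sqrt.congr fun k => ?_
      rw [Real.sqrt_sq (norm_nonneg _)]
    have a2 := (hkr.mul a1).add (hkr.mul hr)
    rw [zero_mul, zero_mul, add_zero] at a2
    refine squeeze_zero (fun k => mul_nonneg (Nat.cast_nonneg k) (hfix k)) (fun k => ?_) a2
    have : j k - y = (x k - y) - (x k - j k) := by abel
    have e : ⟪x k - j k, j k - y⟫ ≤ ‖x k - j k‖ * ‖x k - y‖ + ‖x k - j k‖ * ‖x k - j k‖ := by
      refine (real_inner_le_norm _ _).trans ?_
      rw [this, ← mul_add]
      exact mul_le_mul_of_nonneg_left (norm_sub_le _ _) (norm_nonneg _)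
    have := mul_le_mul_of_nonneg_left e (Nat.cast_nonneg (α := ℝ) k)
    linarith
  · have := h5.add h4
    rw [add_zero] at this
    refine squeeze_zero (fun k => by positivity) (fun k => ?_) this
    rw [hv, ← mul_add]
    exact mul_le_mul_of_nonneg_left (norm_sub_le _ _) (Nat.cast_nonneg k)

/-- As `θ ≥ 1`, the norms satisfy `(k + σ) ‖d (k + 1)‖ ≤ (k + σ - 1) ‖d k‖ + ‖e k‖` for large `k`,
so that `k ‖d k‖` is bounded, up to a constant, by the partial sums of `‖e k‖`; their Cesàro means
tend to zero. -/
theorem tendsto_zero_of_recursion {θ σ : ℝ} (hθ : 1 ≤ θ) {d e : ℕ → E}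
    (hd : ∀ k : ℕ, (k + σ) • d (k + 1) = (k + σ - θ) • d k + e k)
    (he : Tendsto (fun k => ‖e k‖) atTop (𝓝 0)) : Tendsto (fun k => ‖d k‖) atTop (𝓝 0) := by
  obtain ⟨N, hN⟩ := exists_nat_ge (θ - σ)
  have hb : ∀ n : ℕ, ((n : ℝ) + N + σ - 1) * ‖d (n + N)‖
      ≤ (N + σ - 1) * ‖d N‖ + ∑ i ∈ Finset.range n, ‖e (i + N)‖ := by
    intro n
    induction n with
    | zero => simp
    | succ n ih =>
      rw [Finset.sum_range_succ]
      have hn : (0 : ℝ) ≤ n := Nat.cast_nonneg n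
      have h := hd (n + N)
      have h' := congrArg norm h
      rw [norm_smul, Real.norm_eq_abs] at h'
      push_cast at h'
      rw [abs_of_nonneg (by linarith)] at h'
      have h2 := norm_add_le (((n : ℝ) + N + σ - θ) • d (n + N)) (e (n + N))
      rw [← h', norm_smul, Real.norm_eq_abs, abs_of_nonneg (by linarith)] at h2
      have h3 : ((n : ℝ) + N + σ - θ) * ‖d (n + N)‖ ≤ ((n : ℝ) + N + σ - 1) * ‖d (n + N)‖ :=
        mul_le_mul_of_nonneg_right (by linarith) (norm_nonneg _)
      rw [show n + 1 + N = n + N + 1 by omega]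
      push_cast
      linarith
  rw [← tendsto_add_atTop_iff_nat N]
  have hces := ((tendsto_inv_atTop_nhds_zero_nat (𝕜 := ℝ)).mul_const ((N + σ - 1) * ‖d N‖)).add
    ((tendsto_add_atTop_iff_nat N).2 he).cesaro
  rw [zero_mul, add_zero] at hces
  refine squeeze_zero' (Eventually.of_forall fun _ => norm_nonneg _) ?_ hces
  filter_upwards [eventually_gt_atTop 0] with n hn
  have hn' : (0 : ℝ) < n := by exact_mod_cast hn
  rw [← mul_add, inv_mul_eq_div, le_div_iff₀ hn']
  have : (n : ℝ) * ‖d (n + N)‖ ≤ ((n : ℝ) + N + σ - 1) * ‖d (n + N)‖ :=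
    mul_le_mul_of_nonneg_right (by linarith) (norm_nonneg _)
  linarith [hb n]

end Iteration

/-! ### Weak convergence and maximal monotone operators -/

section Weak

variable {H : Type*} [NormedAddCommGroup H] [InnerProductSpace ℝ H]

/-- Weak convergence tested against vectors, by the Riesz representation. -/
theorem weakTendsto_iff [CompleteSpace H] {x : ℕ → H} {l : H} :
    WeakTendsto x l ↔ ∀ y : H, Tendsto (fun k => ⟪x k, y⟫) atTop (𝓝 ⟪l, y⟫) := by
  have hinj : Function.Injective ((topDualPairing ℝ H).flip) := by
    intro a b hab
    refine ext_inner_left ℝ fun v => ?_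
    exact LinearMap.congr_fun hab (InnerProductSpace.toDual ℝ H v)
  refine (WeakBilin.tendsto_iff_forall_eval_tendsto _ hinj).trans ?_
  constructor
  · intro h y
    have := h (InnerProductSpace.toDual ℝ H y)
    have e : ∀ v, InnerProductSpace.toDual ℝ H y v = ⟪v, y⟫ := fun v => by
      rw [InnerProductSpace.toDual_apply_apply, real_inner_comm]
    simp only [← e]
    exact this
  · intro h f
    have := h ((InnerProductSpace.toDual ℝ H).symm f)
    have e : ∀ v, ⟪v, (InnerProductSpace.toDual ℝ H).symm f⟫ = f v := fun v => by
      rw [real_inner_comm, InnerProductSpace.toDual_symm_apply]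
    simp only [e] at this
    exact this

/-- Weak compactness of balls, in terms of ultrafilters: Banach–Alaoglu and Riesz representation. -/
theorem exists_inner_limit [CompleteSpace H] {ι : Type*} (f : Ultrafilter ι) {x : ι → H} {R : ℝ}
    (hx : ∀ᶠ k in f, ‖x k‖ ≤ R) :
    ∃ l : H, ∀ y, Tendsto (fun k => ⟪x k, y⟫) f (𝓝 ⟪l, y⟫) := by
  have hc : IsCompact (WeakDual.toStrongDual ⁻¹' Metric.closedBall (0 : StrongDual ℝ H) R) :=
    WeakDual.isCompact_closedBall 0 R
  obtain ⟨φ, -, hφ⟩ := hc.ultrafilter_le_nhds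
    (f.map fun k => StrongDual.toWeakDual (InnerProductSpace.toDual ℝ H (x k))) (by
      rw [le_principal_iff, Ultrafilter.mem_coe, Ultrafilter.mem_map, ← Ultrafilter.mem_coe]
      filter_upwards [hx] with k hk
      simpa using hk)
  refine ⟨(InnerProductSpace.toDual ℝ H).symm (WeakDual.toStrongDual φ), fun y => ?_⟩
  rw [InnerProductSpace.toDual_symm_apply]
  exact ((WeakDual.eval_continuous y).tendsto φ).comp hφ

theorem WeakTendsto.add_tendsto_zero [CompleteSpace H] {x y : ℕ → H} {l : H}
    (hx : WeakTendsto x l) (hy : Tendsto y atTop (𝓝 0)) : WeakTendsto (fun k => x k + y k) l := by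
  rw [weakTendsto_iff] at hx ⊢
  intro v
  have := (hx v).add (hy.inner (tendsto_const_nhds (x := v)))
  simpa [inner_add_left] using this

theorem WeakTendsto.map [CompleteSpace H] {D : Type*} [NormedAddCommGroup D]
    [InnerProductSpace ℝ D] [CompleteSpace D] {x : ℕ → H} {l : H}
    (hx : WeakTendsto x l) (C : H →L[ℝ] D) : WeakTendsto (fun k => C (x k)) (C l) := by
  rw [weakTendsto_iff] at hx ⊢
  intro v
  simpa [ContinuousLinearMap.adjoint_inner_right] using hx (ContinuousLinearMap.adjoint C v)

/-- The graph of a maximal monotone operator is closed for weak × strong limits of bounded families;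
here at strong limit `0`. -/
theorem IsMaximalMonotone.zero_mem_of_tendsto {A : H → Set H} (hA : IsMaximalMonotone A)
    {ι : Type*} {f : Filter ι} [f.NeBot] {x a : ι → H} {l : H} {R : ℝ}
    (ha : ∀ k, a k ∈ A (x k)) (hxR : ∀ᶠ k in f, ‖x k‖ ≤ R)
    (hx : ∀ y, Tendsto (fun k => ⟪x k, y⟫) f (𝓝 ⟪l, y⟫)) (ha0 : Tendsto a f (𝓝 0)) :
    l ∈ zer A := by
  have hl : ∀ v b, b ∈ A v → 0 ≤ ⟪b, v - l⟫ := by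
    intro v b hb
    have h1 : Tendsto (fun k => ⟪a k, x k - v⟫) f (𝓝 0) := by
      have hb' : Tendsto (fun k => ‖a k‖ * (R + ‖v‖)) f (𝓝 0) := by
        simpa using ha0.norm.mul_const (R + ‖v‖)
      refine squeeze_zero_norm' ?_ hb'
      filter_upwards [hxR] with k hk
      refine (norm_inner_le_norm _ _).trans (mul_le_mul_of_nonneg_left ?_ (norm_nonneg _))
      exact (norm_sub_le _ _).trans (by linarith)
    have h2 : Tendsto (fun k => ⟪a k - b, x k - v⟫) f (𝓝 (0 - (⟪l, b⟫ - ⟪v, b⟫))) := by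
      refine (h1.sub ((hx b).sub_const _)).congr fun k => ?_
      rw [inner_sub_left, inner_sub_right b, real_inner_comm b, real_inner_comm b]
    have h3 := ge_of_tendsto' h2 fun k => hA.1 _ _ _ _ (ha k) hb
    rw [inner_sub_right, real_inner_comm, real_inner_comm l]
    linarith
  -- `hl` says that `(l, 0)` can be added to the graph of `A`
  have hB := hA.2 (fun v => A v ∪ {b | v = l ∧ b = 0}) ?_ fun v => Set.subset_union_left
  · change (0 : H) ∈ A l
    rw [← hB]
    exact Or.inr ⟨rfl, rfl⟩
  · rintro v v' b b' (hb | ⟨rfl, rfl⟩) (hb' | ⟨rfl, rfl⟩)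
    · exact hA.1 _ _ _ _ hb hb'
    · simpa using hl _ _ hb
    · have := hl _ _ hb'
      rw [zero_sub, inner_neg_left, ← inner_neg_right, neg_sub]
      exact this
    · simp

end Weak

/-! ### The seminorm of a positive operator -/

section Seminorm

universe u

/-- The semi-inner product `⟨u, v⟩_M` is the inner product of a seminormed space, namely `H` itself
with its norm replaced. The linear map `S` (the identity) keeps the two structures apart. -/
theorem exists_seminormed_realization {H : Type u} [NormedAddCommGroup H] [InnerProductSpace ℝ H]
    {M : H →L[ℝ] H} (hM : M.IsPositive) :
    ∃ (E : Type u) (_ : SeminormedAddCommGroup E) (_ : InnerProductSpace ℝ E) (S : H →ₗ[ℝ] E),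
      ∀ u v, ⟪S u, S v⟫ = innerM M u v := by
  have hsymm : ∀ u v, innerM M u v = innerM M v u := fun u v => by
    rw [innerM, innerM, real_inner_comm]
    exact hM.inner_left_eq_inner_right v u
  let c : PreInnerProductSpace.Core ℝ H :=
    { inner := innerM M
      conj_inner_symm := fun x y => hsymm y x
      re_inner_nonneg := fun x => hM.inner_nonneg_right x
      add_left := fun x y z => by simp [innerM, inner_add_left]
      smul_left := fun x y r => by simp [innerM, real_inner_smul_left] }
  exact ⟨H, @InnerProductSpace.Core.toSeminormedAddCommGroup ℝ H _ _ _ c,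
    @InnerProductSpace.ofCore ℝ H _ _ _ c, LinearMap.id, fun u v => rfl⟩

theorem normM_eq_norm {H E : Type*} [NormedAddCommGroup H] [InnerProductSpace ℝ H]
    [SeminormedAddCommGroup E] [InnerProductSpace ℝ E] {M : H →L[ℝ] H} {S : H → E}
    (hS : ∀ u v, ⟪S u, S v⟫ = innerM M u v) (v : H) : normM M v = ‖S v‖ := by
  rw [normM, ← hS, real_inner_self_eq_norm_sq, Real.sqrt_sq (norm_nonneg _)]

/-- `M` is bounded from the seminorm `‖v‖_M = ‖S v‖` to the norm of `H`. -/
theorem norm_apply_le_of_inner_eq {H E : Type*} [NormedAddCommGroup H]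
    [InnerProductSpace ℝ H] [SeminormedAddCommGroup E] [InnerProductSpace ℝ E]
    {M : H →L[ℝ] H} {S : H →ₗ[ℝ] E} (hS : ∀ u v, ⟪S u, S v⟫ = innerM M u v) (v : H) :
    ‖M v‖ ≤ √‖M‖ * ‖S v‖ := by
  have h1 : ‖S (M v)‖ ≤ √‖M‖ * ‖M v‖ := by
    refine abs_le_of_sq_le_sq' ?_ (by positivity) |>.2
    rw [mul_pow, Real.sq_sqrt (norm_nonneg _), ← real_inner_self_eq_norm_sq, hS, innerM]
    calc _ ≤ ‖M v‖ * ‖M (M v)‖ := real_inner_le_norm _ _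
      _ ≤ ‖M v‖ * (‖M‖ * ‖M v‖) := mul_le_mul_of_nonneg_left (M.le_opNorm _) (norm_nonneg _)
      _ = _ := by ring
  have h2 : ‖M v‖ ^ 2 ≤ ‖S (M v)‖ * ‖S v‖ := by
    rw [← real_inner_self_eq_norm_sq]
    exact (hS (M v) v).symm.le.trans (real_inner_le_norm _ _)
  rcases (norm_nonneg (M v)).eq_or_lt with h0 | h0
  · rw [← h0]; positivity
  · refine le_of_mul_le_mul_left ?_ h0
    have := mul_le_mul_of_nonneg_right h1 (norm_nonneg (S v))
    linarith

end Seminorm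

/-! ### Resolvents -/

section Resolvent
variable {H : Type*} [NormedAddCommGroup H] [InnerProductSpace ℝ H]

theorem mem_resolventOp_precond {A : H → Set H} {M : H →L[ℝ] H} {u v : H} :
    v ∈ resolventOp (precond M A) u ↔ M (u - v) ∈ A v := by
  constructor
  · rintro ⟨b, hb, rfl⟩
    rwa [show id v + b - v = b by simp]
  · intro h
    exact ⟨u - v, h, by simp⟩

theorem mem_inv_addMap {A : H → Set H} {M : H →L[ℝ] H} {u v : H}
    (h : M (u - v) ∈ A v) : v ∈ inv (addMap M A) (M u) :=
  ⟨M (u - v), h, by simp⟩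

/-- Opial's argument for the seminorm `‖S u‖ = ‖u‖_M`. The points `J (x k)` are bounded in the norm
of `H`, as `J` is Lipschitz from the seminorm to the norm, and all their weak cluster points are
zeros of `A`. Two cluster points are at zero `M`-distance, and `J` does not separate such points.
Ultrafilters replace weakly convergent subsequences. -/
theorem exists_weakTendsto_resolvent [CompleteSpace H] {E : Type*} [SeminormedAddCommGroup E]
    [InnerProductSpace ℝ E] {A : H → Set H} (hA : IsMaximalMonotone A) (hzer : (zer A).Nonempty)
    {M : H →L[ℝ] H} {S : H →ₗ[ℝ] E} (hS : ∀ u v, ⟪S u, S v⟫ = innerM M u v)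
    {J : H → H} {L : ℝ} (hJ : ∀ u, M (u - J u) ∈ A (J u)) (hfix : ∀ z ∈ zer A, J z = z)
    (hL : ∀ u v, ‖J u - J v‖ ≤ L * ‖S (u - v)‖) {x : ℕ → H}
    (hr : Tendsto (fun k => ‖S (x k - J (x k))‖) atTop (𝓝 0))
    (hx : ∀ z ∈ zer A, ∃ l, Tendsto (fun k => ‖S (x k - z)‖ ^ 2) atTop (𝓝 l)) :
    ∃ z ∈ zer A, WeakTendsto (fun k => J (x k)) z := by
  obtain ⟨R, hR⟩ : ∃ R, ∀ᶠ k in atTop, ‖J (x k)‖ ≤ R := by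
    obtain ⟨z, hz⟩ := hzer
    obtain ⟨l, hl⟩ := hx z hz
    refine ⟨‖z‖ + |L| * √(l + 1), ?_⟩
    filter_upwards [hl.eventually_le_const (by linarith : l < l + 1)] with k hk
    have h1 := hL (x k) z
    rw [hfix z hz] at h1
    have h2 : ‖S (x k - z)‖ ≤ √(l + 1) := Real.le_sqrt_of_sq_le hk
    have h3 : L * ‖S (x k - z)‖ ≤ |L| * √(l + 1) :=
      mul_le_mul (le_abs_self L) h2 (norm_nonneg _) (abs_nonneg L)
    have := norm_sub_norm_le (J (x k)) z
    linarith
  have ha0 : Tendsto (fun k => M (x k - J (x k))) atTop (𝓝 0) := by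
    refine squeeze_zero_norm (fun k => norm_apply_le_of_inner_eq hS _) ?_
    simpa using hr.const_mul √‖M‖
  have hcluster : ∀ f : Ultrafilter ℕ, (f : Filter ℕ) ≤ atTop → ∃ z ∈ zer A, ∀ y,
      Tendsto (fun k => ⟪J (x k), y⟫) f (𝓝 ⟪z, y⟫) := by
    intro f hf
    obtain ⟨z, hz⟩ := exists_inner_limit f (hR.filter_mono hf)
    exact ⟨z, hA.zero_mem_of_tendsto (fun k => hJ (x k)) (hR.filter_mono hf) hz
      (ha0.mono_left hf), hz⟩
  have hunique : ∀ f₁ f₂ : Ultrafilter ℕ, (f₁ : Filter ℕ) ≤ atTop → (f₂ : Filter ℕ) ≤ atTop →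
      ∀ z₁ ∈ zer A, ∀ z₂ ∈ zer A, (∀ y, Tendsto (fun k => ⟪J (x k), y⟫) f₁ (𝓝 ⟪z₁, y⟫)) →
      (∀ y, Tendsto (fun k => ⟪J (x k), y⟫) f₂ (𝓝 ⟪z₂, y⟫)) → z₁ = z₂ := by
    intro f₁ f₂ hf₁ hf₂ z₁ hz₁ z₂ hz₂ hl₁ hl₂
    obtain ⟨l₁, h₁⟩ := hx z₁ hz₁
    obtain ⟨l₂, h₂⟩ := hx z₂ hz₂
    -- `‖x k - z₁‖_M ^ 2 - ‖x k - z₂‖_M ^ 2` determines `⟨x k, z₁ - z₂⟩_M`, which therefore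
    -- converges, and so does `⟨J (x k), z₁ - z₂⟩_M`
    have hr' : Tendsto (fun k => ⟪S (x k - J (x k)), S (z₁ - z₂)⟫) atTop (𝓝 0) := by
      refine squeeze_zero_norm (fun k => norm_inner_le_norm _ _) ?_
      simpa using hr.mul_const ‖S (z₁ - z₂)‖
    obtain ⟨c, hc⟩ : ∃ c, Tendsto (fun k => ⟪J (x k), M (z₁ - z₂)⟫) atTop (𝓝 c) := by
      refine ⟨_, ((((h₂.sub h₁).add_const (‖S z₁‖ ^ 2 - ‖S z₂‖ ^ 2)).div_const 2).sub hr').congr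
        fun k => ?_⟩
      change _ = innerM M (J (x k)) (z₁ - z₂)
      rw [← hS]
      simp only [map_sub, norm_sub_sq_real, inner_sub_left, inner_sub_right]
      ring
    have e₁ := tendsto_nhds_unique (hl₁ (M (z₁ - z₂))) (hc.mono_left hf₁)
    have e₂ := tendsto_nhds_unique (hl₂ (M (z₁ - z₂))) (hc.mono_left hf₂)
    have e : ‖S (z₁ - z₂)‖ = 0 := by
      rw [← sq_eq_zero_iff, ← real_inner_self_eq_norm_sq, hS, innerM, inner_sub_left, e₁, e₂,
        sub_self]
    have := hL z₁ z₂
    rw [e, mul_zero, hfix z₁ hz₁, hfix z₂ hz₂] at this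
    exact sub_eq_zero.1 (norm_le_zero_iff.1 this)
  have h0 := Ultrafilter.of_le (atTop : Filter ℕ)
  obtain ⟨z, hz, hlim⟩ := hcluster _ h0
  refine ⟨z, hz, weakTendsto_iff.2 fun y => (tendsto_iff_ultrafilter _ _ _).2 fun f hf => ?_⟩
  obtain ⟨z', hz', hlim'⟩ := hcluster f hf
  rw [hunique _ _ h0 hf z hz z' hz' hlim hlim']
  exact hlim' y

variable {D : Type*} [NormedAddCommGroup D] [InnerProductSpace ℝ D] [CompleteSpace D]
  [CompleteSpace H]

/-- The range of `C*` is dense as `C` is injective, and closed since `C` maps it onto the closed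
range of `M`. -/
theorem IsOntoDecomposition.adjoint_surjective {M : H →L[ℝ] H} {C : D →L[ℝ] H}
    (h : IsOntoDecomposition M C) : Function.Surjective (ContinuousLinearMap.adjoint C) := by
  obtain ⟨hcl, hinj, rfl⟩ := h
  intro d
  have hdense : (ContinuousLinearMap.adjoint C).range.topologicalClosure = ⊤ := by
    rw [Submodule.topologicalClosure_eq_top_iff, ContinuousLinearMap.orthogonal_range,
      ContinuousLinearMap.adjoint_adjoint]
    exact LinearMap.ker_eq_bot.2 hinj
  have hd : d ∈ closure (Set.range (ContinuousLinearMap.adjoint C)) := by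
    have : d ∈ (ContinuousLinearMap.adjoint C).range.topologicalClosure := by
      rw [hdense]; trivial
    exact this
  have hCd : C d ∈ closure (Set.range (C ∘L ContinuousLinearMap.adjoint C)) := by
    have := image_closure_subset_closure_image C.continuous (Set.mem_image_of_mem C hd)
    rw [← Set.range_comp] at this
    exact this
  rw [hcl.closure_eq] at hCd
  obtain ⟨u, hu⟩ := hCd
  exact ⟨u, hinj hu⟩

theorem mem_resolventOp_pushForward {A : H → Set H} {C : D →L[ℝ] H} {d v : D} :
    v ∈ resolventOp (pushForward C A) d ↔
      ∃ x, C (d - ContinuousLinearMap.adjoint C x) ∈ A x ∧ ContinuousLinearMap.adjoint C x = v := by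
  constructor
  · rintro ⟨b, ⟨x, hx, rfl⟩, rfl⟩
    refine ⟨x, ?_, rfl⟩
    rwa [id, add_sub_cancel_left]
  · rintro ⟨x, hx, rfl⟩
    exact ⟨d - ContinuousLinearMap.adjoint C x, ⟨x, hx, rfl⟩, by simp⟩

theorem mem_zer_pushForward {A : H → Set H} {C : D →L[ℝ] H} {y : D} :
    y ∈ zer (pushForward C A) ↔ ∃ z ∈ zer A, ContinuousLinearMap.adjoint C z = y := by
  simp [zer, pushForward, inv]

end Resolvent

end FastKM

open FastKM

/-! ### Convergence of the preconditioned iteration -/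

theorem mainTheorem3
    {H : Type*} [NormedAddCommGroup H] [InnerProductSpace ℝ H] [CompleteSpace H]
    (A : H → Set H) (hA : IsMaximalMonotone A) (hzer : (zer A).Nonempty)
    (M : H →L[ℝ] H) (hM : M.IsPositive)
    (hLip : IsLipschitzOver (inv (addMap M A)) (Set.range M))
    (hdom : ∀ u, (resolventOp (precond M A) u).Nonempty)
    (J : H → H) (hJ : J = value (resolventOp (precond M A)))
    (s α θ σ : ℝ) (hs : s ∈ Set.Ioc 0 2) (hα : 2 < α) (hθ : θ ∈ Set.Ioo 1 (α - 1)) (hσ : 0 < σ)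
    (u : ℤ → H) (hu : IsFastKM (fun x => (1 - s) • x + s • J x) α θ σ u) :
    -- summability
    (∀ z ∈ zer A, Summable (fun k : ℕ => innerM M (u k - J (u k)) (J (u k) - z))) ∧
    Summable (fun k : ℕ => (k : ℝ) * normM M (u k - J (u k)) ^ 2) ∧
    Summable (fun k : ℕ => (k : ℝ) * normM M (u k - u (k - 1)) ^ 2) ∧
    -- rates
    (∀ z ∈ zer A, (fun k : ℕ => innerM M (u k - J (u k)) (J (u k) - z))
      =o[atTop] (fun k : ℕ => (k : ℝ)⁻¹)) ∧
    (fun k : ℕ => normM M (u k - u (k - 1))) =o[atTop] (fun k : ℕ => (k : ℝ)⁻¹) ∧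
    (fun k : ℕ => normM M (u k - J (u k))) =o[atTop] (fun k : ℕ => (k : ℝ)⁻¹) ∧
    -- weak convergence, and the reduced sequence `w k = C* (u k)`
    ∃ z ∈ zer A,
      WeakTendsto (fun k : ℕ => J (u k)) z ∧
      (s = 1 → WeakTendsto (fun k : ℕ => u k) z) ∧
      ∀ {D : Type*} [NormedAddCommGroup D] [InnerProductSpace ℝ D] [CompleteSpace D]
        (C : D →L[ℝ] H), IsOntoDecomposition M C →
        -- the resolvent of `C* ▷ A` is single-valued and everywhere defined
        (∀ d, ∃! v, v ∈ resolventOp (pushForward C A) d) ∧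
        ∀ (w : ℤ → D) (R : D → D), (∀ k, w k = ContinuousLinearMap.adjoint C (u k)) →
          R = value (resolventOp (pushForward C A)) →
          (∀ y ∈ zer (pushForward C A),
            Summable (fun k : ℕ => ⟪w k - R (w k), R (w k) - y⟫)) ∧
          Summable (fun k : ℕ => (k : ℝ) * ‖w k - R (w k)‖ ^ 2) ∧
          Summable (fun k : ℕ => (k : ℝ) * ‖w k - w (k - 1)‖ ^ 2) ∧
          (∀ y ∈ zer (pushForward C A),
            (fun k : ℕ => ⟪w k - R (w k), R (w k) - y⟫) =o[atTop] (fun k : ℕ => (k : ℝ)⁻¹)) ∧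
          (fun k : ℕ => ‖w k - w (k - 1)‖) =o[atTop] (fun k : ℕ => (k : ℝ)⁻¹) ∧
          (fun k : ℕ => ‖w k - R (w k)‖) =o[atTop] (fun k : ℕ => (k : ℝ)⁻¹) ∧
          ContinuousLinearMap.adjoint C z ∈ zer (pushForward C A) ∧
          WeakTendsto (fun k : ℕ => R (w k)) (ContinuousLinearMap.adjoint C z) ∧
          WeakTendsto (fun k : ℕ => w k) (ContinuousLinearMap.adjoint C z) := by
  have hJM : ∀ v, M (v - J v) ∈ A (J v) := fun v =>
    mem_resolventOp_precond.1 (hJ ▸ value_mem (hdom v))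
  obtain ⟨L, hL⟩ := hLip
  -- a point `p` with `M (v - p) ∈ A p` lies in `(M + A)⁻¹ (M v)`, which has a single element
  have huniq : ∀ v p, M (v - p) ∈ A p → p = J v := by
    intro v p hp
    have := hL _ ⟨v, rfl⟩ _ ⟨v, rfl⟩ p (mem_inv_addMap hp) (J v) (mem_inv_addMap (hJM v))
    rw [sub_self, norm_zero, mul_zero] at this
    exact sub_eq_zero.1 (norm_le_zero_iff.1 this)
  have hfix : ∀ z ∈ zer A, J z = z := fun z hz =>
    (huniq z z (by rw [sub_self, map_zero]; exact hz)).symm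
  obtain ⟨E, _, _, S, hS⟩ := exists_seminormed_realization hM
  have hnorm := normM_eq_norm (S := S) hS
  have hJL : ∀ v v', ‖J v - J v'‖ ≤ |L| * √‖M‖ * ‖S (v - v')‖ := by
    intro v v'
    have h1 := hL _ ⟨v, rfl⟩ _ ⟨v', rfl⟩ _ (mem_inv_addMap (hJM v)) _ (mem_inv_addMap (hJM v'))
    have h2 := norm_apply_le_of_inner_eq hS (v - v')
    rw [← map_sub] at h1
    calc _ ≤ L * ‖M (v - v')‖ := h1
      _ ≤ |L| * ‖M (v - v')‖ := mul_le_mul_of_nonneg_right (le_abs_self L) (norm_nonneg _)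
      _ ≤ |L| * (√‖M‖ * ‖S (v - v')‖) := mul_le_mul_of_nonneg_left h2 (abs_nonneg L)
      _ = _ := by ring
  have hu' : ∀ k : ℕ, u (k + 2 : ℕ) = u (k + 1 : ℕ)
      + (θ / (k + 1 + σ)) • ((1 - s) • u (k + 1 : ℕ) + s • J (u (k + 1 : ℕ)) - u (k + 1 : ℕ))
      + (1 - α / (k + 1 + σ)) • ((1 - s) • u (k + 1 : ℕ) + s • J (u (k + 1 : ℕ))
        - ((1 - s) • u k + s • J (u k))) := by
    intro k
    have h := hu (k + 1)
    rw [show ((k + 1 : ℕ) : ℤ) + 1 = (k + 2 : ℕ) by push_cast; ring,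
      show ((k + 1 : ℕ) : ℤ) - 1 = k by push_cast; ring,
      show ((k + 1 : ℕ) : ℝ) = k + 1 by push_cast; ring] at h
    exact h
  have hmono : ∀ v v', 0 ≤ ⟪S (J v) - S (J v'), (S v - S (J v)) - (S v' - S (J v'))⟫ := by
    intro v v'
    rw [← map_sub, ← map_sub, ← map_sub, ← map_sub, hS, innerM, map_sub, real_inner_comm]
    exact hA.1 _ _ _ _ (hJM v) (hJM v')
  have hmain := fun z (hz : z ∈ zer A) =>
    fastKM_asymptotics hs hθ hσ (x := fun k : ℕ => S (u k)) (j := fun k : ℕ => S (J (u k)))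
      (y := S z)
      (fun k => by simpa only [map_add, map_sub, map_smul] using congrArg S (hu' k))
      (fun k => hmono _ _)
      (fun k => by
        have := hmono (u k) z
        rw [hfix z hz, sub_self, sub_zero, real_inner_comm] at this
        exact this)
  simp only [← map_sub, hS, ← hnorm] at hmain
  have hinner : ∀ z ∈ zer A, Summable (fun k : ℕ => innerM M (u k - J (u k)) (J (u k) - z)) ∧
      (fun k : ℕ => innerM M (u k - J (u k)) (J (u k) - z))
        =o[atTop] (fun k : ℕ => (k : ℝ)⁻¹) := fun z hz =>
    ⟨(hmain z hz).1, isLittleO_natCast_inv (hmain z hz).2.2.2.1⟩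
  obtain ⟨z₀, hz₀⟩ := id hzer
  obtain ⟨-, hsumr, hsumv, -, hr, hv, -⟩ := hmain z₀ hz₀
  have hn : ∀ v, 0 ≤ normM M v := fun v => Real.sqrt_nonneg _
  have hshift : ∀ k : ℕ, ((k + 1 : ℕ) : ℤ) - 1 = k := fun k => by push_cast; ring
  have hsumv' : Summable (fun k : ℕ => (k : ℝ) * normM M (u k - u (k - 1)) ^ 2) := by
    rw [← summable_nat_add_iff 1]
    simpa only [hshift] using summable_succ_mul (fun k => sq_nonneg _) hsumv
  have hv' : (fun k : ℕ => normM M (u k - u (k - 1))) =o[atTop] (fun k : ℕ => (k : ℝ)⁻¹) := by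
    refine isLittleO_natCast_inv ?_
    rw [← tendsto_add_atTop_iff_nat 1]
    simpa only [hshift] using tendsto_succ_mul (fun k => hn _) hv
  have hr' := isLittleO_natCast_inv hr
  have hr0 := tendsto_zero_of_natCast_mul (fun k => hn _) hr
  have hv0 := tendsto_zero_of_natCast_mul (fun k => hn _) hv
  obtain ⟨z, hz, hlim⟩ := exists_weakTendsto_resolvent hA hzer hS hJM hfix hJL
    (x := fun k : ℕ => u k) (by simpa only [← hnorm] using hr0)
    (fun z hz => by simpa only [← hnorm] using (hmain z hz).2.2.2.2.2.2)
  refine ⟨fun z hz => (hinner z hz).1, hsumr, hsumv', fun z hz => (hinner z hz).2, hv', hr',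
    z, hz, hlim, ?_, ?_⟩
  · rintro rfl
    -- `d k = u (k + 1) - J (u k)` satisfies a contracting recursion with vanishing forcing term
    have hd : Tendsto (fun k : ℕ => ‖u (k + 1 : ℕ) - J (u k)‖) atTop (𝓝 0) := by
      refine tendsto_zero_of_recursion (θ := θ) (σ := σ + 1)
        (e := fun k : ℕ => (θ - α) • (J (u (k + 1 : ℕ)) - J (u k))) hθ.1.le (fun k => ?_) ?_
      · have ht : (k : ℝ) + 1 + σ ≠ 0 := by positivity
        have e1 : ((k : ℝ) + 1 + σ) * (θ / (k + 1 + σ)) = θ := mul_div_cancel₀ _ ht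
        have e2 : ((k : ℝ) + 1 + σ) * (1 - α / (k + 1 + σ)) = k + 1 + σ - α := by
          rw [mul_sub, mul_one, mul_div_cancel₀ _ ht]
        have h := congrArg (fun v => ((k : ℝ) + 1 + σ) • v) (hu' k)
        simp only [smul_add, smul_smul ((k : ℝ) + 1 + σ), e1, e2] at h
        rw [show (k : ℝ) + (σ + 1) = k + 1 + σ by ring, smul_sub, h]
        module
      · have hb := (hv0.const_mul (|L| * √‖M‖)).const_mul |θ - α|
        rw [mul_zero, mul_zero] at hb
        refine squeeze_zero (fun k => norm_nonneg _) (fun k => ?_) hb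
        rw [norm_smul, Real.norm_eq_abs, hnorm]
        exact mul_le_mul_of_nonneg_left (hJL _ _) (abs_nonneg _)
    have hsucc := hlim.add_tendsto_zero (tendsto_zero_iff_norm_tendsto_zero.2 hd)
    simp only [add_sub_cancel] at hsucc
    exact (tendsto_add_atTop_iff_nat 1).1 hsucc
  · intro D _ _ _ C hC
    have hCS : ∀ v v', ⟪ContinuousLinearMap.adjoint C v, ContinuousLinearMap.adjoint C v'⟫
        = innerM M v v' := fun v v' => by
      rw [ContinuousLinearMap.adjoint_inner_left, innerM, hC.2.2]
      rfl
    have hCnorm := normM_eq_norm (S := ContinuousLinearMap.adjoint C) hCS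
    have hCM : ∀ v, C (ContinuousLinearMap.adjoint C v) = M v := fun v => by rw [hC.2.2]; rfl
    -- the resolvent of `C* ▷ A` at `C* v` is `C* (J v)`
    have hres : ∀ v p, p ∈ resolventOp (pushForward C A) (ContinuousLinearMap.adjoint C v) ↔
        p = ContinuousLinearMap.adjoint C (J v) := by
      intro v p
      rw [mem_resolventOp_pushForward]
      simp only [← map_sub, hCM]
      constructor
      · rintro ⟨q, hq, rfl⟩
        rw [huniq v q hq]
      · rintro rfl
        exact ⟨J v, hJM v, rfl⟩
    have hex : ∀ d, ∃! p, p ∈ resolventOp (pushForward C A) d := by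
      intro d
      obtain ⟨v, rfl⟩ := hC.adjoint_surjective d
      exact ⟨_, (hres v _).2 rfl, fun p hp => (hres v p).1 hp⟩
    refine ⟨hex, fun w R hw hR => ?_⟩
    have hRw : ∀ v, R (ContinuousLinearMap.adjoint C v) = ContinuousLinearMap.adjoint C (J v) := by
      intro v
      rw [hR]
      exact value_eq (hex _) ((hres _ _).2 rfl)
    have hwlim : WeakTendsto (fun k : ℕ => R (w k)) (ContinuousLinearMap.adjoint C z) := by
      simpa only [hw, hRw] using hlim.map (ContinuousLinearMap.adjoint C)
    have hwr : Tendsto (fun k : ℕ => w k - R (w k)) atTop (𝓝 0) := by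
      rw [tendsto_zero_iff_norm_tendsto_zero]
      simpa only [hw, hRw, ← map_sub, ← hCnorm] using hr0
    have hy : ∀ y ∈ zer (pushForward C A),
        Summable (fun k : ℕ => ⟪w k - R (w k), R (w k) - y⟫) ∧
        (fun k : ℕ => ⟪w k - R (w k), R (w k) - y⟫) =o[atTop] (fun k : ℕ => (k : ℝ)⁻¹) := by
      intro y hy
      obtain ⟨q, hq, rfl⟩ := mem_zer_pushForward.1 hy
      simpa only [hw, hRw, ← map_sub, hCS] using hinner q hq
    refine ⟨fun y h => (hy y h).1, ?_, ?_, fun y h => (hy y h).2, ?_, ?_,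
      mem_zer_pushForward.2 ⟨z, hz, rfl⟩, hwlim, ?_⟩
    · simpa only [hw, hRw, ← map_sub, ← hCnorm] using hsumr
    · simpa only [hw, ← map_sub, ← hCnorm] using hsumv'
    · simpa only [hw, ← map_sub, ← hCnorm] using hv'
    · simpa only [hw, hRw, ← map_sub, ← hCnorm] using hr'
    · simpa only [add_sub_cancel] using hwlim.add_tendsto_zero hwr
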